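/- All graphs here are finite, simple and undirected. For graphs $G$ and $H$, a mapping $f:E(G)\to E(H)$ is a \emph{$TT$ mapping} (a cut-continuous mapping) if for every cut $C$ of $H$ the preimage $f^{-1}(C)$ is a cut of $G$; here a cut of a graph is the set of all edges with one end in $X$ and the other end outside $X$, for some set $X$ of vertices (possibly empty). A graph $G$ is \emph{$TT$-rigid} if the only $TT$ mapping $E(G)\to E(G)$ is the identity. Two graphs $G,H$ are \emph{$TT$-incomparable} if there is no $TT$ mapping from $G$ to $H$ and none from $H$ to $G$. Then: (1) A random graph is almost surely $TT$-rigid: if $G$ is chosen uniformly at random among all graphs with vertex set $\{1,\dots,n\}$, then $$\lim_{n\to\infty}\Pr[\,G\text{ is }TT\text{-rigid}\,]=1.$$ (2) There are $$\frac{1}{n!}\binom{\binom n2}{\left\lfloor \frac12\binom n2\right\rfloor}(1-o(1))$$ pairwise $TT$-incomparable $TT$-rigid graphs on $n$ vertices. That is, there are a sequence of reals $\varepsilon_n\to 0$ and, for every $n$, a set $F_n$ of graphs with vertex set $\{1,\dots,n\}$ such that every member of $F_n$ is $TT$-rigid, any two distinct members of $F_n$ are $TT$-incomparable, and $$|F_n|=\frac{1}{n!}\binom{\binom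 n2}{\left\lfloor \frac12\binom n2\right\rfloor}(1-\varepsilon_n).$$ -/

import Mathlib

open Filter Topology

namespace TTGraph

/-- The cut of `G` given by a vertex set `X`: all edges with one end in `X` and the other
outside `X`. -/
def cut {V : Type*} (G : SimpleGraph V) (X : Set V) : Set G.edgeSet :=
  {e | ∃ u v : V, u ∈ X ∧ v ∉ X ∧ (e : Sym2 V) = s(u, v)}

/-- A set of edges that is the cut given by some vertex set. -/
def IsCut {V : Type*} (G : SimpleGraph V) (C : Set G.edgeSet) : Prop :=
  ∃ X : Set V, C = cut G X

/-- `f : E(G) → E(H)` is a `TT` mapping (cut-continuous mapping) if the preimage of every cut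
of `H` is a cut of `G`. -/
def IsTT {V W : Type*} (G : SimpleGraph V) (H : SimpleGraph W)
    (f : G.edgeSet → H.edgeSet) : Prop :=
  ∀ C : Set H.edgeSet, IsCut H C → IsCut G (f ⁻¹' C)

/-- The only `TT` mapping from `G` to itself is the identity on the edges. -/
def TTRigid {V : Type*} (G : SimpleGraph V) : Prop :=
  ∀ f : G.edgeSet → G.edgeSet, IsTT G G f → f = id

/-- There is no `TT` mapping between `G` and `H`, in either direction. -/
def TTIncomparable {V W : Type*} (G : SimpleGraph V) (H : SimpleGraph W) : Prop :=
  (¬ ∃ f : G.edgeSet → H.edgeSet, IsTT G H f) ∧ (¬ ∃ f : H.edgeSet → G.edgeSet, IsTT H G f)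

/-- The probability that a graph drawn uniformly from all graphs on the vertex set `Fin n`
has property `P`. -/
noncomputable def randomGraphProb (n : ℕ) (P : SimpleGraph (Fin n) → Prop) : ℝ :=
  (Nat.card {G : SimpleGraph (Fin n) // P G} : ℝ) / (Nat.card (SimpleGraph (Fin n)) : ℝ)

/-- A random graph on `n` vertices has property `P` with probability tending to `1`. -/
def AlmostSurely (P : ∀ n : ℕ, SimpleGraph (Fin n) → Prop) : Prop :=
  Tendsto (fun n : ℕ => randomGraphProb n (P n)) atTop (𝓝 1)

end TTGraph

/-! Cut-continuous mappings are controlled through triangles. A cut meets a triangle in zero or two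
edges, so pulling back vertex stars shows that triangles map to triangles. In a 5-clique the images
of the edges at a vertex then share an end, and if few vertices always have a common neighbour,
these ends fit together into a homomorphism inducing the mapping (`IsTT.exists_hom`). The problem
becomes one about homomorphisms.

`Pseudorandom` lists the needed properties of a random graph. Between two such graphs of the same
order every homomorphism is injective (`Pseudorandom.hom_injective`): one identification forces
linearly many, and the resulting pairs would give the target a set that is too dense. With equal
edge counts an injective homomorphism is an isomorphism, and `Pseudorandom.aut_eq_refl` excludes
nontrivial automorphisms. This gives rigidity, and incomparability of non-isomorphic graphs with
equally many edges.

Exponential moments and union bounds show that pseudorandomness fails with probability so small that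
it still vanishes after multiplication by `n.choose 2 + 1`. The central binomial coefficient is at
least the average of the `n.choose 2 + 1` coefficients, so almost all graphs with exactly half the
edges are typical as well. Having trivial automorphism groups, these fall into isomorphism classes
of size `n!`, and one representative per class forms the family. -/

namespace TTGraph

/-! ### Cut-continuous mappings induced by homomorphisms -/

section Induced

variable {V W : Type*} {G : SimpleGraph V} {H : SimpleGraph W}

lemma mem_cut_iff (X : Set V) {u v : V} (h : s(u, v) ∈ G.edgeSet) :
    (⟨s(u, v), h⟩ : G.edgeSet) ∈ cut G X ↔ ¬ (u ∈ X ↔ v ∈ X) := by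
  simp only [cut, Set.mem_ofPred_eq, Sym2.eq_iff]
  constructor
  · rintro ⟨a, b, ha, hb, h | h⟩ <;> obtain ⟨rfl, rfl⟩ := h <;> tauto
  · intro hx
    by_cases hu : u ∈ X
    · exact ⟨u, v, hu, by tauto, by simp⟩
    · exact ⟨v, u, by tauto, hu, by simp⟩

lemma mem_cut_singleton_iff (x : W) (e : H.edgeSet) : e ∈ cut H {x} ↔ x ∈ (e : Sym2 W) := by
  obtain ⟨e, he⟩ := e
  induction e with
  | _ a b =>
    have hab : a ≠ b := H.ne_of_adj he
    rw [mem_cut_iff]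
    simp only [Set.mem_singleton_iff, Sym2.mem_iff]
    constructor
    · intro h; by_contra hx; apply h; constructor <;> intro h <;> subst h <;> simp at hx
    · rintro (rfl | rfl)
      · simp [hab.symm]
      · simp [hab]

/-- `x` is an end of the image of the edge `uv` under `f`. -/
def ImageEnd (f : G.edgeSet → H.edgeSet) (u v : V) (x : W) : Prop :=
  ∃ h : s(u, v) ∈ G.edgeSet, x ∈ (f ⟨s(u, v), h⟩ : Sym2 W)

lemma ImageEnd.symm {f : G.edgeSet → H.edgeSet} {u v : V} {x : W} (h : ImageEnd f u v x) :
    ImageEnd f v u x := by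
  unfold ImageEnd at *
  rwa [Sym2.eq_swap]

lemma exists_imageEnd_iff (f : G.edgeSet → H.edgeSet) {u v : V} (h : G.Adj u v) :
    ∃ a b, a ≠ b ∧ ∀ x, ImageEnd f u v x ↔ x = a ∨ x = b := by
  obtain ⟨⟨e, he⟩, hfe⟩ : ∃ e, f ⟨s(u, v), h⟩ = e := ⟨_, rfl⟩
  induction e with
  | _ a b =>
    refine ⟨a, b, H.ne_of_adj he, fun x => ?_⟩
    constructor
    · rintro ⟨_, hx⟩
      rw [hfe] at hx
      simpa using hx
    · intro hx
      exact ⟨h, by rw [hfe]; simpa using hx⟩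

/-- The star of `x` is a cut, and its preimage, again a cut, meets the triangle in an even number of
edges. -/
lemma IsTT.imageEnd_triangle {f : G.edgeSet → H.edgeSet} (hf : IsTT G H f) {u v w : V}
    (huv : G.Adj u v) (huw : G.Adj u w) (hvw : G.Adj v w) (x : W) :
    ImageEnd f u v x ↔ ¬ (ImageEnd f u w x ↔ ImageEnd f v w x) := by
  obtain ⟨X, hX⟩ := hf _ ⟨{x}, rfl⟩
  have key : ∀ a b, G.Adj a b → (ImageEnd f a b x ↔ ¬ (a ∈ X ↔ b ∈ X)) := by
    intro a b hab
    have h1 : (⟨s(a, b), hab⟩ : G.edgeSet) ∈ f ⁻¹' cut H {x} ↔ ¬ (a ∈ X ↔ b ∈ X) := by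
      rw [hX]; exact mem_cut_iff X hab
    rw [Set.mem_preimage, mem_cut_singleton_iff] at h1
    rw [← h1]
    exact ⟨fun ⟨_, h⟩ => h, fun h => ⟨hab, h⟩⟩
  rw [key _ _ huv, key _ _ huw, key _ _ hvw]
  tauto

/-- A cut-continuous mapping sends triangles to triangles. -/
lemma IsTT.exists_triangle {f : G.edgeSet → H.edgeSet} (hf : IsTT G H f) {u v w : V}
    (huv : G.Adj u v) (huw : G.Adj u w) (hvw : G.Adj v w) :
    ∃ a b c, a ≠ b ∧ a ≠ c ∧ b ≠ c ∧ (∀ x, ImageEnd f u v x ↔ x = a ∨ x = b) ∧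
      (∀ x, ImageEnd f u w x ↔ x = a ∨ x = c) ∧ (∀ x, ImageEnd f v w x ↔ x = b ∨ x = c) := by
  have par := hf.imageEnd_triangle huv huw hvw
  obtain ⟨a, b, hab, h1⟩ := exists_imageEnd_iff f huv
  obtain ⟨c, d, hcd, h2⟩ := exists_imageEnd_iff f huw
  obtain ⟨p, q, hpq, h3⟩ := exists_imageEnd_iff f hvw
  simp only [h1, h2, h3] at par ⊢
  -- Every vertex lies in an even number of the three image edges. Parity at their six listed ends
  -- already forces a triangle.
  have ha := par a
  have hb := par b
  have hc := par c
  have hd := par d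
  have hp := par p
  have hq := par q
  clear par h1 h2 h3
  classical
  by_cases hac : a = c ∨ a = d
  · refine ⟨a, b, if a = c then d else c, ?_⟩
    split_ifs <;> refine ⟨?_, ?_, ?_, ?_, ?_, ?_⟩ <;> grind
  · refine ⟨b, a, if b = c then d else c, ?_⟩
    split_ifs <;> refine ⟨?_, ?_, ?_, ?_, ?_, ?_⟩ <;> grind

/-- Let `vu`, `vw`, `uw` go to `ab`, `ac`, `bc`. If the image of `vx` avoids `a`, it must meet `ab`
in `b` and `ac` in `c`, so it is `bc`. The second alternative is the folding of a 4-clique onto a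
triangle, which a fifth vertex excludes. -/
lemma IsTT.four_clique {f : G.edgeSet → H.edgeSet} (hf : IsTT G H f) {v u w x : V}
    (hvu : G.Adj v u) (hvw : G.Adj v w) (hvx : G.Adj v x)
    (huw : G.Adj u w) (hux : G.Adj u x) (hwx : G.Adj w x) :
    (∃ a, ImageEnd f v u a ∧ ImageEnd f v w a ∧ ImageEnd f v x a) ∨
      (∀ a, ImageEnd f v x a ↔ ImageEnd f u w a) := by
  obtain ⟨a, b, c, hab, hac, hbc, h1, h2, h3⟩ := hf.exists_triangle hvu hvw huw
  obtain ⟨a', b', d, hab', had', hbd', h1', h2', h3'⟩ := hf.exists_triangle hvu hvx hux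
  obtain ⟨p, q, r, hpq, hpr, hqr, k1, k2, k3⟩ := hf.exists_triangle hvw hvx hwx
  by_cases h : ImageEnd f v x a
  · exact Or.inl ⟨a, by grind, by grind, h⟩
  · right
    have e1 : b' = a := by
      have := (h1 a).2 (Or.inl rfl)
      rw [h1'] at this
      grind
    have e2 : a' = b := by
      have := h1' a'
      grind
    have e3 : q = a := by
      have := (h2 a).2 (Or.inl rfl)
      rw [k1] at this
      grind
    have e4 : p = c := by
      have := k1 p
      grind
    have e5 : d = c := by
      have := k2 p
      grind
    intro y
    rw [h2', h3, e2, e5]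

/-- In a clique on five vertices, the images of the edges at a vertex share an end. -/
lemma IsTT.five_clique {f : G.edgeSet → H.edgeSet} (hf : IsTT G H f) {v u w x y : V}
    (hvu : G.Adj v u) (hvw : G.Adj v w) (hvx : G.Adj v x) (hvy : G.Adj v y)
    (huw : G.Adj u w) (hux : G.Adj u x) (huy : G.Adj u y)
    (hwx : G.Adj w x) (hwy : G.Adj w y) (hxy : G.Adj x y) :
    ∃ a, ImageEnd f v u a ∧ ImageEnd f v w a ∧ ImageEnd f v x a := by
  rcases hf.four_clique hvu hvw hvx huw hux hwx with h | h
  · exact h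
  exfalso
  obtain ⟨a, b, c, hab, hac, hbc, h1, h2, h3⟩ := hf.exists_triangle hvu hvw huw
  obtain ⟨p, q, r, hpq, hpr, hqr, k1, k2, k3⟩ := hf.exists_triangle hvx hvy hxy
  -- Here `vx` goes to `bc`. Either `vy` goes through `a` and, meeting `bc`, coincides with the
  -- image of `vu` or `vw`, or it goes to `bc` like `vx`. Both contradict that a triangle has three
  -- distinct image edges.
  rcases hf.four_clique hvu hvw hvy huw huy hwy with ⟨z, z1, z2, z3⟩ | h'
  · obtain ⟨a', b', d, hab', had', hbd', h1', h2', h3'⟩ := hf.exists_triangle hvu hvy huy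
    obtain ⟨a'', b'', d', hab'', had'', hbd'', h1'', h2'', h3''⟩ := hf.exists_triangle hvw hvy hwy
    have e1 : z = a := by grind
    subst e1
    have e2 : z = r := by
      have := h z
      grind
    subst e2
    have e3 : p = b ∨ p = c := by
      have := h p
      grind
    rcases e3 with rfl | rfl
    · have := h1' b'
      have := h2' b'
      grind
    · have := h1'' b''
      have := h2'' b''
      grind
  · have := h q
    have := h' q
    grind

/-- If any five vertices of `G` have a common neighbour, then every cut-continuous mapping from
`G` is induced by a homomorphism. -/
theorem IsTT.exists_hom (hG : ∀ S : Finset V, S.card ≤ 5 → ∃ z, ∀ x ∈ S, G.Adj x z)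
    {f : G.edgeSet → H.edgeSet} (hf : IsTT G H f) :
    ∃ g : G →g H, ∀ e, (f e : Sym2 W) = (e : Sym2 V).map g := by
  classical
  have ext : ∀ a b c d e : V, ∃ z, G.Adj a z ∧ G.Adj b z ∧ G.Adj c z ∧ G.Adj d z ∧ G.Adj e z := by
    intro a b c d e
    obtain ⟨z, hz⟩ := hG {a, b, c, d, e} Finset.card_le_five
    exact ⟨z, hz _ (by simp), hz _ (by simp), hz _ (by simp), hz _ (by simp), hz _ (by simp)⟩
  have four : ∀ v u w x a, G.Adj v u → G.Adj v w → G.Adj v x → G.Adj u w → G.Adj u x → G.Adj w x →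
      ImageEnd f v u a → ImageEnd f v w a → ImageEnd f v x a := by
    intro v u w x a hvu hvw hvx huw hux hwx h1 h2
    obtain ⟨y, hv, hu, hw, hx, -⟩ := ext v u w x x
    obtain ⟨b, hb1, hb2, hb3⟩ := hf.five_clique hvu hvw hvx hv huw hux hu hwx hw hx
    obtain ⟨p, q, r, hpq, hpr, hqr, k1, k2, k3⟩ := hf.exists_triangle hvu hvw huw
    have : a = b := by grind
    rwa [this]
  have point : ∀ v, ∃ a, ∀ u, G.Adj v u → ImageEnd f v u a := by
    intro v
    obtain ⟨u, hvu, -⟩ := ext v v v v v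
    obtain ⟨w, hvw, huw, -⟩ := ext v u u u u
    obtain ⟨a, b, c, hab, hac, hbc, h1, h2, h3⟩ := hf.exists_triangle hvu hvw huw
    have ha1 : ImageEnd f v u a := by simp [h1]
    have ha2 : ImageEnd f v w a := by simp [h2]
    refine ⟨a, fun x hvx => ?_⟩
    -- `x` need not be adjacent to `u` or `w`, so `a` is carried to it along the cliques `vuwz`,
    -- `vuzs`, `vzsx`.
    obtain ⟨z, hvz, huz, hwz, hxz, -⟩ := ext v u w x x
    have hz := four v u w z a hvu hvw hvz huw huz hwz ha1 ha2
    obtain ⟨s, hvs, hus, hxs, hzs, -⟩ := ext v u x z z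
    have hs := four v u z s a hvu hvz hvs huz hus hzs ha1 hz
    exact four v z s x a hvz hvs hvx hzs hxz.symm hxs.symm hz hs
  choose g hg using point
  have key : ∀ u v, G.Adj u v → g u ≠ g v ∧ ∀ x, ImageEnd f u v x ↔ x = g u ∨ x = g v := by
    intro u v huv
    obtain ⟨w, huw, hvw, -⟩ := ext u v v v v
    obtain ⟨a, b, c, hab, hac, hbc, h1, h2, h3⟩ := hf.exists_triangle huv huw hvw
    have e1 := hg u v huv
    have e2 := hg u w huw
    have e3 := (hg v u huv.symm).symm
    have e4 := hg v w hvw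
    have : g u = a := by grind
    have : g v = b := by grind
    grind
  have main : ∀ u v (h : G.Adj u v), (f ⟨s(u, v), h⟩ : Sym2 W) = s(g u, g v) := by
    intro u v h
    obtain ⟨hne, hx⟩ := key u v h
    refine (Sym2.mem_and_mem_iff hne).1 ⟨?_, ?_⟩
    · exact ((hx (g u)).2 (Or.inl rfl)).2
    · exact ((hx (g v)).2 (Or.inr rfl)).2
  refine ⟨⟨g, fun {u v} h => ?_⟩, ?_⟩
  · have := (f ⟨s(u, v), h⟩).2
    rw [main u v h] at this
    exact this
  · rintro ⟨e, he⟩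
    induction e with
    | _ u v => exact main u v he

end Induced

/-! ### Uniform random graphs, union bounds and an exponential tail bound -/

section Counting

open Classical in
/-- A graph as the indicator function of its edges among all pairs of distinct vertices. -/
noncomputable def edgeIndicatorEquiv (V : Type*) :
    SimpleGraph V ≃ ({e : Sym2 V // ¬ e.IsDiag} → Bool) where
  toFun G e := decide ((e : Sym2 V) ∈ G.edgeSet)
  invFun η := SimpleGraph.fromEdgeSet {e | ∃ h : ¬ e.IsDiag, η ⟨e, h⟩ = true}
  left_inv G := by
    ext u v
    simp only [SimpleGraph.fromEdgeSet_adj, Set.mem_ofPred_eq, decide_eq_true_eq,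
      SimpleGraph.mem_edgeSet, Sym2.mk_isDiag_iff, exists_prop]
    exact ⟨fun h => h.1.2, fun h => ⟨⟨h.ne, h⟩, h.ne⟩⟩
  right_inv η := by
    ext ⟨e, he⟩
    simp [SimpleGraph.edgeSet_fromEdgeSet, he]

lemma card_simpleGraph (n : ℕ) : Nat.card (SimpleGraph (Fin n)) = 2 ^ n.choose 2 := by
  rw [Nat.card_congr (edgeIndicatorEquiv (Fin n)), Nat.card_eq_fintype_card, Fintype.card_fun,
    Fintype.card_bool, Sym2.card_subtype_not_diag, Fintype.card_fin]

/-- The restriction of a uniform function to an injectively indexed family of points is uniform. -/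
lemma card_comp_mul {A B : Type*} [Fintype A] [Fintype B] (e : A → B) (he : e.Injective)
    (P : (A → Bool) → Prop) :
    Nat.card {η : B → Bool // P (η ∘ e)} * 2 ^ Fintype.card A =
      Nat.card {θ : A → Bool // P θ} * 2 ^ Fintype.card B := by
  classical
  let φ : (B → Bool) ≃ (A → Bool) × ({b // b ∉ Set.range e} → Bool) :=
    (Equiv.piEquivPiSubtypeProd (fun b => b ∈ Set.range e) (fun _ => Bool)).trans
      (Equiv.prodCongr (Equiv.arrowCongr (Equiv.ofInjective e he).symm (Equiv.refl _))
        (Equiv.refl _))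
  have hφ : ∀ η, (φ η).1 = η ∘ e := fun η => rfl
  let ψ : {η : B → Bool // P (η ∘ e)} ≃ {θ : A → Bool // P θ} × ({b // b ∉ Set.range e} → Bool) :=
    (φ.subtypeEquiv (q := fun x => P x.1) (fun η => by rw [hφ])).trans
      (Equiv.prodSubtypeFstEquivSubtypeProd (p := P))
  have hB := Nat.card_congr φ
  have hP := Nat.card_congr ψ
  rw [Nat.card_prod] at hB hP
  rw [hP, mul_assoc, mul_comm (Nat.card (_ → Bool))]
  congr 1
  simpa [Nat.card_eq_fintype_card] using hB.symm

open Classical in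
/-- The restriction of a random graph to a family of distinct pairs of vertices is uniform. -/
lemma randomGraphProb_restrict {n : ℕ} {A : Type*} [Fintype A] (e : A → Sym2 (Fin n))
    (he : e.Injective) (hd : ∀ a, ¬ (e a).IsDiag) (P : (A → Bool) → Prop) :
    randomGraphProb n (fun G => P (fun a => decide (e a ∈ G.edgeSet))) =
      (Nat.card {θ : A → Bool // P θ} : ℝ) / 2 ^ Fintype.card A := by
  let e' : A → {e : Sym2 (Fin n) // ¬ e.IsDiag} := fun a => ⟨e a, hd a⟩
  have he' : e'.Injective := fun a b h => he (congrArg Subtype.val h)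
  have h := card_comp_mul e' he' P
  have h1 : Nat.card {G : SimpleGraph (Fin n) // P (fun a => decide (e a ∈ G.edgeSet))} =
      Nat.card {η : {e : Sym2 (Fin n) // ¬ e.IsDiag} → Bool // P (η ∘ e')} :=
    Nat.card_congr ((edgeIndicatorEquiv (Fin n)).subtypeEquiv fun G => Iff.rfl)
  rw [Sym2.card_subtype_not_diag, Fintype.card_fin] at h
  rw [randomGraphProb, h1, card_simpleGraph, div_eq_div_iff (by positivity) (by positivity)]
  exact_mod_cast h

lemma randomGraphProb_mono {n : ℕ} {P Q : SimpleGraph (Fin n) → Prop} (h : ∀ G, P G → Q G) :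
    randomGraphProb n P ≤ randomGraphProb n Q := by
  unfold randomGraphProb
  gcongr
  exact Nat.card_le_card_of_injective _ (Subtype.map_injective h Function.injective_id)

lemma randomGraphProb_nonneg (n : ℕ) (P : SimpleGraph (Fin n) → Prop) :
    0 ≤ randomGraphProb n P := by
  unfold randomGraphProb; positivity

lemma randomGraphProb_eq_card_filter (n : ℕ) (P : SimpleGraph (Fin n) → Prop)
    [DecidablePred P] :
    randomGraphProb n P = (Finset.univ.filter P).card / (2 : ℝ) ^ n.choose 2 := by
  classical
  rw [randomGraphProb, card_simpleGraph, Nat.card_eq_fintype_card, Fintype.card_subtype]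
  push_cast
  congr!

lemma randomGraphProb_exists_le {n : ℕ} {ι : Type*} [Fintype ι]
    (P : ι → SimpleGraph (Fin n) → Prop) {c : ℝ} (h : ∀ i, randomGraphProb n (P i) ≤ c) :
    randomGraphProb n (fun G => ∃ i, P i G) ≤ Fintype.card ι * c := by
  classical
  calc randomGraphProb n (fun G => ∃ i, P i G)
      ≤ ∑ i, randomGraphProb n (P i) := by
        simp only [randomGraphProb_eq_card_filter, ← Finset.sum_div]
        gcongr
        have : (Finset.univ.filter fun G => ∃ i, P i G) =
            Finset.univ.biUnion fun i => Finset.univ.filter (P i) := by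
          ext G; simp
        rw [this]
        exact_mod_cast Finset.card_biUnion_le
    _ ≤ ∑ _i : ι, c := Finset.sum_le_sum fun i _ => h i
    _ = _ := by simp

lemma randomGraphProb_or_le {n : ℕ} (P Q : SimpleGraph (Fin n) → Prop) :
    randomGraphProb n (fun G => P G ∨ Q G) ≤ randomGraphProb n P + randomGraphProb n Q := by
  classical
  simp only [randomGraphProb_eq_card_filter, ← add_div]
  gcongr
  rw [Finset.filter_or]
  exact_mod_cast Finset.card_union_le _ _

lemma randomGraphProb_not (n : ℕ) (P : SimpleGraph (Fin n) → Prop) :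
    randomGraphProb n (fun G => ¬ P G) = 1 - randomGraphProb n P := by
  classical
  simp only [randomGraphProb_eq_card_filter]
  have h := Finset.card_filter_add_card_filter_not (s := Finset.univ) P
  rw [Finset.card_univ, ← Nat.card_eq_fintype_card, card_simpleGraph] at h
  rw [eq_sub_iff_add_eq, ← add_div, div_eq_one_iff_eq (by positivity)]
  have h' := congrArg (Nat.cast (R := ℝ)) h
  push_cast at h'
  linarith

/-- Exponential tail bound for the number of blocks `j` on which a random indicator function
satisfies `Q`. -/
lemma card_block_tail_le {J K : Type*} [Fintype J] [Fintype K] [DecidableEq K]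
    (Q : (K → Bool) → Prop) [DecidablePred Q] (a b : ℕ) {μ ρ : ℝ} (hμ : 1 ≤ μ)
    (hE : (∑ θ : K → Bool, if Q θ then μ ^ b else 1) ≤ ρ * μ ^ a * 2 ^ Fintype.card K) :
    (Nat.card {θ : J × K → Bool // a * Fintype.card J ≤
      b * (Finset.univ.filter fun j => Q fun k => θ (j, k)).card} : ℝ) ≤
      ρ ^ Fintype.card J * 2 ^ Fintype.card (J × K) := by
  classical
  set M := Fintype.card J
  have hμ0 : 0 < μ := by linarith
  -- Markov's inequality for `μ ^ (b * X)`, where `X` counts the blocks satisfying `Q`.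
  have h1 : (Nat.card {θ : J × K → Bool // a * M ≤
      b * (Finset.univ.filter fun j => Q fun k => θ (j, k)).card} : ℝ) * μ ^ (a * M) ≤
      ∑ θ : J × K → Bool, μ ^ (b * (Finset.univ.filter fun j => Q fun k => θ (j, k)).card) := by
    rw [Nat.card_eq_fintype_card, Fintype.card_subtype, ← nsmul_eq_mul, ← Finset.sum_const]
    refine (Finset.sum_le_sum fun θ hθ => ?_).trans
      (Finset.sum_le_sum_of_subset_of_nonneg (Finset.subset_univ _) fun _ _ _ => by positivity)
    exact pow_le_pow_right₀ hμ (by simpa using hθ)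
  -- The blocks are independent, so the moment factorises.
  have h2 : ∑ θ : J × K → Bool,
      μ ^ (b * (Finset.univ.filter fun j => Q fun k => θ (j, k)).card) =
      (∑ θ : K → Bool, if Q θ then μ ^ b else 1) ^ M := by
    rw [show M = (Finset.univ : Finset J).card from rfl, ← Finset.prod_const,
      Finset.prod_univ_sum, Fintype.piFinset_univ]
    refine Fintype.sum_equiv (Equiv.curry J K Bool) _ _ fun θ => ?_
    rw [pow_mul, Finset.prod_ite]
    simp only [Finset.prod_const, one_pow, mul_one]
    rfl
  have h3 : (∑ θ : K → Bool, if Q θ then μ ^ b else 1) ^ M ≤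
      (ρ * μ ^ a * 2 ^ Fintype.card K) ^ M := by
    refine pow_le_pow_left₀ (Finset.sum_nonneg fun θ _ => ?_) hE M
    split_ifs <;> positivity
  have h4 : (ρ * μ ^ a * 2 ^ Fintype.card K) ^ M =
      (ρ ^ M * 2 ^ Fintype.card (J × K)) * μ ^ (a * M) := by
    rw [Fintype.card_prod, mul_pow, mul_pow, ← pow_mul, ← pow_mul, mul_comm M]
    ring
  rw [h2] at h1
  exact le_of_mul_le_mul_right ((h1.trans h3).trans h4.le) (by positivity)

open Classical in
lemma randomGraphProb_block_tail_le {n : ℕ} {J K : Type*} [Fintype J] [Fintype K] [DecidableEq K]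
    (e : J × K → Sym2 (Fin n)) (he : e.Injective) (hd : ∀ x, ¬ (e x).IsDiag)
    (Q : (K → Bool) → Prop) [DecidablePred Q] (a b : ℕ) {μ ρ : ℝ} (hμ : 1 ≤ μ)
    (hE : (∑ θ : K → Bool, if Q θ then μ ^ b else 1) ≤ ρ * μ ^ a * 2 ^ Fintype.card K) :
    randomGraphProb n (fun G => a * Fintype.card J ≤
      b * (Finset.univ.filter fun j => Q fun k => decide (e (j, k) ∈ G.edgeSet)).card) ≤
      ρ ^ Fintype.card J := by
  rw [randomGraphProb_restrict e he hd (fun θ => a * Fintype.card J ≤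
    b * (Finset.univ.filter fun j => Q fun k => θ (j, k)).card), div_le_iff₀ (by positivity)]
  exact card_block_tail_le Q a b hμ hE

open Classical in
lemma card_filter_ncard_edgeSet (n k : ℕ) :
    (Finset.univ.filter fun G : SimpleGraph (Fin n) => G.edgeSet.ncard = k).card =
      (n.choose 2).choose k := by
  have hN := SimpleGraph.card_edgeFinset_top_eq_card_choose_two (V := Fin n)
  rw [Fintype.card_fin] at hN
  rw [← hN, ← Finset.card_powersetCard]
  have hc : ∀ G : SimpleGraph (Fin n), G.edgeFinset.card = G.edgeSet.ncard := fun G => by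
    rw [← SimpleGraph.coe_edgeFinset, Set.ncard_coe_finset]
  refine Finset.card_bij (fun G _ => G.edgeFinset) (fun G hG => ?_) (fun G _ G' _ h => ?_)
    (fun S hS => ?_)
  · simp only [Finset.mem_filter, Finset.mem_univ, true_and] at hG
    rw [Finset.mem_powersetCard, hc]
    refine ⟨?_, hG⟩
    intro e he
    rw [SimpleGraph.mem_edgeFinset] at he ⊢
    exact SimpleGraph.edgeSet_mono le_top he
  · exact SimpleGraph.edgeFinset_inj.1 h
  · rw [Finset.mem_powersetCard] at hS
    obtain ⟨G, hE⟩ : ∃ G : SimpleGraph (Fin n), G.edgeSet = S := by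
      refine ⟨SimpleGraph.fromEdgeSet S, ?_⟩
      ext e
      rw [SimpleGraph.edgeSet_fromEdgeSet]
      constructor
      · exact fun h => h.1
      · intro h
        have h' := hS.1 h
        rw [SimpleGraph.mem_edgeFinset] at h'
        exact ⟨h, by simpa using h'⟩
    refine ⟨G, ?_, Finset.coe_injective ((SimpleGraph.coe_edgeFinset _).trans hE)⟩
    simp only [Finset.mem_filter, Finset.mem_univ, true_and]
    rw [hE, Set.ncard_coe_finset, hS.2]

end Counting

/-! ### Rigidity of pseudorandom graphs -/

section Pseudorandom

/-- The pairs `i < j` of elements of `Fin t`. -/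
abbrev IncreasingPair (t : ℕ) : Type := {p : Fin t × Fin t // p.1 < p.2}

open Classical in
/-- Properties of a typical graph with edge density one half: adjacencies of one or two vertices
and between few pairs of vertices are distributed roughly as expected. -/
structure Pseudorandom {V : Type*} [Fintype V] (t : ℕ) (G : SimpleGraph V) : Prop where
  common_neighbor : ∀ ψ : Fin 5 ↪ V, ∃ z, ∀ i, G.Adj (ψ i) z
  degree_le : ∀ v, 5 * (Finset.univ.filter fun z => G.Adj v z).card ≤ 3 * Fintype.card V
  nonadj_le : ∀ x y, x ≠ y → 10 * (Finset.univ.filter fun z => z ≠ x ∧ z ≠ y ∧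
    ¬ G.Adj x z ∧ ¬ G.Adj y z).card ≤ 3 * Fintype.card V
  agree_le : ∀ x y, x ≠ y → 5 * (Finset.univ.filter fun z => z ≠ x ∧ z ≠ y ∧
    (G.Adj x z ↔ G.Adj y z)).card ≤ 3 * Fintype.card V
  exists_adj : ∀ φ : Fin t ↪ V, ∃ p : IncreasingPair t, G.Adj (φ p.1.1) (φ p.1.2)
  -- The constants of this and the next field are complementary: merging each pair `φ (i, 0)`, `φ
  -- (i, 1)` would produce density above 7/8. The expected proportions are 1/16 and 1/2.
  pairs_lt : ∀ φ : Fin t × Fin 2 ↪ V, 8 * (Finset.univ.filter fun p : IncreasingPair t =>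
    ∀ k l, ¬ G.Adj (φ (p.1.1, k)) (φ (p.1.2, l))).card < Fintype.card (IncreasingPair t)
  density_lt : ∀ φ : Fin t ↪ V, 8 * (Finset.univ.filter fun p : IncreasingPair t =>
    G.Adj (φ p.1.1) (φ p.1.2)).card < 7 * Fintype.card (IncreasingPair t)
  exists_disagree : ∀ φ : Fin t × Fin 2 ↪ V, ∃ p : IncreasingPair t,
    ¬ (G.Adj (φ (p.1.1, 0)) (φ (p.1.2, 0)) ↔ G.Adj (φ (p.1.1, 1)) (φ (p.1.2, 1)))

variable {V : Type*} [Fintype V] {G H : SimpleGraph V} {t : ℕ}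

lemma Pseudorandom.exists_common_neighbor (hG : Pseudorandom t G) (hV : 5 ≤ Fintype.card V)
    (S : Finset V) (hS : S.card ≤ 5) : ∃ z, ∀ x ∈ S, G.Adj x z := by
  obtain ⟨T, hST, -, hT⟩ := Finset.exists_subsuperset_card_eq (Finset.subset_univ S) hS
    (by rwa [Finset.card_univ])
  obtain ⟨z, hz⟩ := hG.common_neighbor
    ((T.equivFinOfCardEq hT).symm.toEmbedding.trans (Function.Embedding.subtype _))
  refine ⟨z, fun x hx => ?_⟩
  simpa using hz (T.equivFinOfCardEq hT ⟨x, hST hx⟩)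

/-- An independent set of a pseudorandom graph is small. -/
lemma Pseudorandom.card_lt_of_independent (hG : Pseudorandom t G) (S : Finset V)
    (hS : ∀ x ∈ S, ∀ y ∈ S, ¬ G.Adj x y) : S.card < t := by
  by_contra! h
  obtain ⟨T, hTS, hT⟩ := Finset.exists_subset_card_eq h
  obtain ⟨p, hp⟩ := hG.exists_adj
    ((T.equivFinOfCardEq hT).symm.toEmbedding.trans (Function.Embedding.subtype _))
  exact hS _ (hTS (by simp)) _ (hTS (by simp)) hp

open Classical in
/-- The vertices whose fibre under `g` is not a singleton. -/
noncomputable def mergedVertices (g : V → V) : Finset V :=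
  Finset.univ.filter fun z => ∃ z', z' ≠ z ∧ g z' = g z

/-- The neighbours of `x` or `y` number at least `7n/10 - 2`, yet all map into the neighbourhood of
`g x`, of size at most `3n/5`. Unmerged ones map injectively, so about `n/10` must be merged. -/
lemma Pseudorandom.card_mergedVertices (hG : Pseudorandom t G) (hH : Pseudorandom t H)
    (g : G →g H) {x y : V} (hxy : x ≠ y) (hg : g x = g y) :
    Fintype.card V ≤ 10 * (mergedVertices g).card + 20 := by
  classical
  set S := Finset.univ.filter fun z => G.Adj x z ∨ G.Adj y z
  have h1 := hG.nonadj_le x y hxy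
  set N := Finset.univ.filter fun z => z ≠ x ∧ z ≠ y ∧ ¬ G.Adj x z ∧ ¬ G.Adj y z
  have h2 : Fintype.card V ≤ S.card + N.card + 2 := by
    have : (Finset.univ : Finset V) ⊆ S ∪ N ∪ {x, y} := by
      intro z _
      simp only [S, N, Finset.mem_union, Finset.mem_filter, Finset.mem_univ, true_and,
        Finset.mem_insert, Finset.mem_singleton]
      tauto
    calc Fintype.card V = (Finset.univ : Finset V).card := rfl
      _ ≤ _ := Finset.card_le_card this
      _ ≤ _ := Finset.card_union_le _ _
      _ ≤ S.card + N.card + 2 := add_le_add (Finset.card_union_le _ _) Finset.card_le_two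
  have h3 := hH.degree_le (g x)
  have h4 : (S \ mergedVertices g).card ≤ (Finset.univ.filter fun z => H.Adj (g x) z).card := by
    refine Finset.card_le_card_of_injOn g (fun z hz => ?_) (fun z hz z' hz' h => ?_)
    · simp only [S, Finset.coe_sdiff, Finset.coe_filter, Finset.mem_univ, true_and,
        Set.mem_sdiff, Set.mem_ofPred_eq] at hz ⊢
      rcases hz.1 with h | h
      · exact g.map_adj h
      · rw [hg]; exact g.map_adj h
    · by_contra hne
      simp only [Finset.coe_sdiff, Set.mem_sdiff, mergedVertices, Finset.coe_filter,
        Finset.mem_univ, true_and, Set.mem_ofPred_eq] at hz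
      exact hz.2 ⟨z', Ne.symm hne, h.symm⟩
  have h5 : S.card ≤ (S \ mergedVertices g).card + (mergedVertices g).card := by
    have := Finset.le_card_sdiff (mergedVertices g) S
    omega
  omega

/-- Homomorphisms between pseudorandom graphs of the same order are injective. -/
theorem Pseudorandom.hom_injective (hG : Pseudorandom t G) (hH : Pseudorandom t H)
    (ht : 16 * t ^ 2 ≤ Fintype.card V) (hV : 100 ≤ Fintype.card V) (g : G →g H) :
    Function.Injective g := by
  classical
  intro x y hg
  by_contra hxy
  have h1 := hG.card_mergedVertices hH g hxy hg
  set M := mergedVertices g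
  have h2 : M.card ≤ t * (M.image g).card := by
    refine Finset.card_le_mul_card_image M t fun w _ => ?_
    refine (hG.card_lt_of_independent _ fun a ha b hb hab => ?_).le
    rw [Finset.mem_filter] at ha hb
    have := g.map_adj hab
    rw [ha.2, hb.2] at this
    exact H.loopless.irrefl _ this
  have h3 : t ≤ (M.image g).card := by
    by_contra! h
    have : t * (M.image g).card ≤ t * t := Nat.mul_le_mul_left t h.le
    nlinarith
  obtain ⟨T, hTM, hT⟩ := Finset.exists_subset_card_eq h3
  let w : Fin t ↪ V := (T.equivFinOfCardEq hT).symm.toEmbedding.trans (Function.Embedding.subtype _)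
  have hw : ∀ i, ∃ a b, b ≠ a ∧ g a = w i ∧ g b = w i := by
    intro i
    have : w i ∈ M.image g := hTM (by simp [w])
    obtain ⟨a, ha, hga⟩ := Finset.mem_image.1 this
    obtain ⟨b, hb, hgb⟩ := (Finset.mem_filter.1 ha).2
    exact ⟨a, b, hb, hga, hgb.trans hga⟩
  choose a b hab ha hb using hw
  let φ : Fin t × Fin 2 → V := fun p => if p.2 = 0 then a p.1 else b p.1
  have hφ : ∀ p, g (φ p) = w p.1 := by
    intro p
    simp only [φ]
    split_ifs
    · exact ha _
    · exact hb _
  have hinj : Function.Injective φ := by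
    rintro ⟨i, k⟩ ⟨j, l⟩ h
    have hij : i = j := by
      have := congrArg g h
      rw [hφ, hφ] at this
      exact w.injective this
    subst hij
    have h1 := hab i
    have h2 := (hab i).symm
    fin_cases k <;> fin_cases l <;> simp_all [φ]
  have h4 := hG.pairs_lt ⟨φ, hinj⟩
  have h5 := hH.density_lt w
  have h6 := Finset.card_filter_add_card_filter_not (s := Finset.univ)
    fun p : IncreasingPair t => ∀ k l, ¬ G.Adj (φ (p.1.1, k)) (φ (p.1.2, l))
  have h7 : (Finset.univ.filter fun p : IncreasingPair t =>
      ¬ ∀ k l, ¬ G.Adj (φ (p.1.1, k)) (φ (p.1.2, l))).card ≤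
      (Finset.univ.filter fun p : IncreasingPair t => H.Adj (w p.1.1) (w p.1.2)).card := by
    refine Finset.card_le_card fun p hp => ?_
    simp only [Finset.mem_filter, Finset.mem_univ, true_and, not_forall, not_not] at hp ⊢
    obtain ⟨k, l, h⟩ := hp
    have := g.map_adj h
    rwa [hφ, hφ] at this
  rw [Finset.card_univ] at h6
  simp only [Function.Embedding.coeFn_mk] at h4
  omega

/-- A permutation moving at least `3 * k` points maps some `k`-element set off itself. -/
lemma exists_card_eq_disjoint_image [DecidableEq V] (σ : Equiv.Perm V) (k : ℕ)
    (hk : 3 * k ≤ σ.support.card) :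
    ∃ A : Finset V, A.card = k ∧ Disjoint A (A.image σ) := by
  induction k with
  | zero => exact ⟨∅, by simp⟩
  | succ k ih =>
    obtain ⟨A, hA, hd⟩ := ih (by omega)
    -- A new point must avoid `A`, its image and its preimage, at most `3 * k` points in all.
    have hlt : (A ∪ A.image σ ∪ A.image σ.symm).card < σ.support.card := by
      have := Finset.card_union_le (A ∪ A.image σ) (A.image σ.symm)
      have := Finset.card_union_le A (A.image σ)
      have := Finset.card_image_le (s := A) (f := σ)
      have := Finset.card_image_le (s := A) (f := σ.symm)
      omega
    obtain ⟨x, hx, hxA⟩ := Finset.exists_mem_notMem_of_card_lt_card hlt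
    simp only [Finset.mem_union, Finset.mem_image, not_or, not_exists, not_and] at hxA
    rw [Equiv.Perm.mem_support] at hx
    refine ⟨insert x A, by rw [Finset.card_insert_of_notMem hxA.1.1, hA], ?_⟩
    rw [Finset.disjoint_left] at hd ⊢
    simp only [Finset.mem_insert, Finset.mem_image, not_exists, not_and] at hd ⊢
    rintro a (rfl | ha) b (rfl | hb) h
    · exact hx h
    · exact hxA.1.2 b hb h
    · exact hxA.2 a ha (by rw [← h]; simp)
    · exact hd ha b hb h

/-- A pseudorandom graph has no nontrivial automorphism. -/
theorem Pseudorandom.aut_eq_refl (hG : Pseudorandom t G)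
    (ht : 16 * t ^ 2 ≤ Fintype.card V) (hV : 100 ≤ Fintype.card V) (σ : G ≃g G) (x : V) :
    σ x = x := by
  classical
  by_contra hx
  have hsupp : 3 * t ≤ (Equiv.Perm.support σ.toEquiv).card := by
    have h1 := hG.agree_le x (σ x) (Ne.symm hx)
    -- A fixed point `z` is adjacent to both or neither of `x` and `σ x`, so `agree_le` bounds the
    -- fixed points by `3n/5`.
    have h2 : (Equiv.Perm.support σ.toEquiv)ᶜ ⊆ Finset.univ.filter fun z => z ≠ x ∧ z ≠ σ x ∧
        (G.Adj x z ↔ G.Adj (σ x) z) := by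
      intro z hz
      rw [Finset.mem_compl, Equiv.Perm.mem_support, not_not] at hz
      have hz' : σ z = z := hz
      simp only [Finset.mem_filter, Finset.mem_univ, true_and]
      refine ⟨?_, ?_, ?_⟩
      · rintro rfl; exact hx hz'
      · rintro rfl; exact hx (σ.injective hz')
      · rw [← σ.map_adj_iff, hz']
    have h3 := Finset.card_le_card h2
    rw [Finset.card_compl] at h3
    have h4 : 3 * t ≤ t ^ 2 + 3 := by nlinarith [sq_nonneg ((t : ℤ) - 2), sq_nonneg ((t : ℤ) - 1)]
    omega
  obtain ⟨A, hA, hd⟩ := exists_card_eq_disjoint_image σ.toEquiv t hsupp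
  let w : Fin t ↪ V := (A.equivFinOfCardEq hA).symm.toEmbedding.trans (Function.Embedding.subtype _)
  have hw : ∀ i, w i ∈ A := fun i => by simp [w]
  let φ : Fin t × Fin 2 → V := fun p => if p.2 = 0 then w p.1 else σ (w p.1)
  have hne : ∀ i j, w i ≠ σ (w j) := fun i j h =>
    Finset.disjoint_left.1 hd (hw i) (Finset.mem_image.2 ⟨_, hw j, h.symm⟩)
  have hinj : Function.Injective φ := by
    rintro ⟨i, k⟩ ⟨j, l⟩ h
    have h1 := hne i j
    have h2 := (hne j i).symm
    fin_cases k <;> fin_cases l <;> simp_all [φ]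
  obtain ⟨p, hp⟩ := hG.exists_disagree ⟨φ, hinj⟩
  exact hp (by simpa [φ] using σ.map_adj_iff.symm)

/-- An injective homomorphism between finite graphs with equally many vertices and equally many
edges is an isomorphism. -/
lemma exists_iso_of_injective (g : G →g H) (hg : Function.Injective g)
    (hE : G.edgeSet.ncard = H.edgeSet.ncard) : ∃ σ : G ≃g H, ⇑σ = g := by
  have himg : Sym2.map g '' G.edgeSet = H.edgeSet := by
    refine Set.eq_of_subset_of_ncard_le ?_ ?_ (Set.toFinite _)
    · rintro _ ⟨e, he, rfl⟩
      exact g.map_mem_edgeSet he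
    · rw [Set.ncard_image_of_injective _ (Sym2.map.injective hg), hE]
  refine ⟨⟨Equiv.ofBijective g (Finite.injective_iff_bijective.1 hg), fun {a b} => ?_⟩, rfl⟩
  change H.Adj (g a) (g b) ↔ G.Adj a b
  refine ⟨fun h => ?_, fun h => g.map_adj h⟩
  have : s(g a, g b) ∈ Sym2.map g '' G.edgeSet := by rw [himg]; exact h
  obtain ⟨e, he, h'⟩ := this
  have : e = s(a, b) := Sym2.map.injective hg (by rw [h']; rfl)
  rwa [this] at he

/-- Pseudorandom graphs are rigid for cut-continuous mappings. -/
theorem Pseudorandom.ttRigid (hG : Pseudorandom t G)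
    (ht : 16 * t ^ 2 ≤ Fintype.card V) (hV : 100 ≤ Fintype.card V) : TTRigid G := by
  intro f hf
  obtain ⟨g, hgf⟩ := hf.exists_hom (hG.exists_common_neighbor (by omega))
  obtain ⟨σ, hσ⟩ := exists_iso_of_injective g (hG.hom_injective hG ht hV g) rfl
  have hid : ⇑g = id := by
    funext x
    rw [← hσ]
    exact hG.aut_eq_refl ht hV σ x
  funext e
  apply Subtype.ext
  rw [hgf, hid, Sym2.map_id]
  rfl

/-- A cut-continuous mapping between pseudorandom graphs with equally many vertices and edges
forces them to be isomorphic. -/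
theorem Pseudorandom.nonempty_iso (hG : Pseudorandom t G) (hH : Pseudorandom t H)
    (ht : 16 * t ^ 2 ≤ Fintype.card V) (hV : 100 ≤ Fintype.card V)
    (hE : G.edgeSet.ncard = H.edgeSet.ncard) (h : ∃ f, IsTT G H f) : Nonempty (G ≃g H) := by
  obtain ⟨f, hf⟩ := h
  obtain ⟨g, -⟩ := hf.exists_hom (hG.exists_common_neighbor (by omega))
  obtain ⟨σ, -⟩ := exists_iso_of_injective g (hG.hom_injective hH ht hV g) hE
  exact ⟨σ⟩

end Pseudorandom

/-! ### Random graphs are pseudorandom -/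

section RandomPseudorandom

/-- Reduces the moment hypothesis of the tail bounds to counting the patterns satisfying `Q`. -/
lemma sum_ite_pow_eq {K : Type*} [Fintype K] [DecidableEq K] (Q : (K → Bool) → Prop)
    [DecidablePred Q] (c : ℝ) :
    (∑ θ : K → Bool, if Q θ then c else 1) =
      2 ^ Fintype.card K + (Finset.univ.filter Q).card * (c - 1) := by
  have h := Finset.card_filter_add_card_filter_not (s := Finset.univ) Q
  rw [Finset.card_univ, Fintype.card_fun, Fintype.card_bool] at h
  have h' := congrArg (Nat.cast (R := ℝ)) h
  push_cast at h'
  rw [Finset.sum_ite, Finset.sum_const, Finset.sum_const, nsmul_eq_mul, nsmul_eq_mul, ← h']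
  ring

lemma card_filter_ne_embedding {V κ : Type*} [Fintype V] [DecidableEq V] [Fintype κ]
    (ψ : κ ↪ V) [DecidablePred fun z => ∀ k, z ≠ ψ k] :
    (Finset.univ.filter fun z => ∀ k, z ≠ ψ k).card = Fintype.card V - Fintype.card κ := by
  have h1 : (Finset.univ.filter fun z => ∀ k, z ≠ ψ k) = Finset.univ \ Finset.univ.image ψ := by
    ext z
    simp [eq_comm]
  rw [h1, Finset.card_sdiff_of_subset (Finset.subset_univ _),
    Finset.card_image_of_injective _ ψ.injective, Finset.card_univ, Finset.card_univ]

open Classical in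
/-- Tail bound for the adjacency patterns of the other vertices to a fixed set of vertices. -/
lemma randomGraphProb_star_le (n : ℕ) {κ : Type*} [Fintype κ] [DecidableEq κ]
    (Q : (κ → Bool) → Prop) [DecidablePred Q] (a b : ℕ) {μ ρ : ℝ} (hμ : 1 ≤ μ)
    (hE : 2 ^ Fintype.card κ + (Finset.univ.filter Q).card * (μ ^ b - 1) ≤
      ρ * μ ^ a * 2 ^ Fintype.card κ) (hρ : 0 ≤ ρ) :
    randomGraphProb n (fun G => ∃ ψ : κ ↪ Fin n, a * (n - Fintype.card κ) ≤
      b * (Finset.univ.filter fun z : Fin n => (∀ k, z ≠ ψ k) ∧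
        Q fun k => decide (G.Adj (ψ k) z)).card) ≤
      n ^ Fintype.card κ * ρ ^ (n - Fintype.card κ) := by
  have hcard : (Fintype.card (κ ↪ Fin n) : ℝ) ≤ n ^ Fintype.card κ := by
    rw [Fintype.card_embedding_eq, Fintype.card_fin]
    exact_mod_cast Nat.descFactorial_le_pow _ _
  refine (randomGraphProb_exists_le _ (c := ρ ^ (n - Fintype.card κ)) fun ψ => ?_).trans
    (by gcongr)
  let J := {z : Fin n // ∀ k, z ≠ ψ k}
  have hJ : Fintype.card J = n - Fintype.card κ := by
    rw [Fintype.card_subtype, card_filter_ne_embedding, Fintype.card_fin]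
  let e : J × κ → Sym2 (Fin n) := fun x => s(ψ x.2, x.1)
  have he : e.Injective := by
    rintro ⟨⟨z, hz⟩, k⟩ ⟨⟨z', hz'⟩, k'⟩ h
    simp only [e, Sym2.eq_iff] at h
    rcases h with ⟨h1, h2⟩ | ⟨h1, h2⟩
    · simp [ψ.injective h1, h2]
    · exact absurd h1.symm (hz' k)
  have hd : ∀ x, ¬ (e x).IsDiag := fun x h => x.1.2 x.2 (Sym2.mk_isDiag_iff.1 h).symm
  have := randomGraphProb_block_tail_le e he hd Q a b hμ (by rw [sum_ite_pow_eq]; exact hE)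
  rw [hJ] at this
  refine (randomGraphProb_mono fun G hG => hG.trans ?_).trans this
  refine Nat.mul_le_mul_left b (le_of_eq ?_)
  refine (Finset.card_bij (fun (z : J) _ => z.val) (fun z hz => ?_)
    (fun z _ z' _ h => Subtype.ext h) (fun z hz => ?_)).symm
  · simp only [Finset.mem_filter, Finset.mem_univ, true_and] at hz ⊢
    exact ⟨z.2, hz⟩
  · simp only [Finset.mem_filter, Finset.mem_univ, true_and] at hz
    exact ⟨⟨z, hz.1⟩, by simpa [e] using hz.2, rfl⟩

open Classical in
/-- Tail bound for the adjacency patterns between the members of a family of disjoint tuples. -/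
lemma randomGraphProb_pair_le (n t : ℕ) {κ : Type*} [Fintype κ] [DecidableEq κ]
    (Q : (κ × κ → Bool) → Prop) [DecidablePred Q] (a b : ℕ) {μ ρ : ℝ} (hμ : 1 ≤ μ)
    (hE : 2 ^ Fintype.card (κ × κ) + (Finset.univ.filter Q).card * (μ ^ b - 1) ≤
      ρ * μ ^ a * 2 ^ Fintype.card (κ × κ)) (hρ : 0 ≤ ρ) :
    randomGraphProb n (fun G => ∃ φ : Fin t × κ ↪ Fin n, a * Fintype.card (IncreasingPair t) ≤
      b * (Finset.univ.filter fun p : IncreasingPair t =>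
        Q fun k => decide (G.Adj (φ (p.1.1, k.1)) (φ (p.1.2, k.2)))).card) ≤
      n ^ (t * Fintype.card κ) * ρ ^ Fintype.card (IncreasingPair t) := by
  have hcard : (Fintype.card (Fin t × κ ↪ Fin n) : ℝ) ≤ n ^ (t * Fintype.card κ) := by
    rw [Fintype.card_embedding_eq, Fintype.card_fin, Fintype.card_prod, Fintype.card_fin]
    exact_mod_cast Nat.descFactorial_le_pow _ _
  refine (randomGraphProb_exists_le _ (c := ρ ^ Fintype.card (IncreasingPair t))
    fun φ => ?_).trans (by gcongr)
  let e : IncreasingPair t × (κ × κ) → Sym2 (Fin n) :=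
    fun x => s(φ (x.1.1.1, x.2.1), φ (x.1.1.2, x.2.2))
  have he : e.Injective := by
    rintro ⟨⟨⟨i, j⟩, hij⟩, k, l⟩ ⟨⟨⟨i', j'⟩, hij'⟩, k', l'⟩ h
    simp only [e, Sym2.eq_iff, φ.injective.eq_iff, Prod.mk.injEq] at h
    rcases h with ⟨⟨rfl, rfl⟩, rfl, rfl⟩ | ⟨⟨rfl, rfl⟩, rfl, rfl⟩
    · rfl
    · exact absurd hij (not_lt_of_gt hij')
  have hd : ∀ x, ¬ (e x).IsDiag := by
    rintro ⟨⟨⟨i, j⟩, hij⟩, k, l⟩ h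
    simp only [e, Sym2.mk_isDiag_iff, φ.injective.eq_iff, Prod.mk.injEq] at h
    exact hij.ne h.1
  exact randomGraphProb_block_tail_le e he hd Q a b hμ (by rw [sum_ite_pow_eq]; exact hE)

lemma two_mul_card_increasingPair_add (t : ℕ) :
    2 * Fintype.card (IncreasingPair t) + t = t * t := by
  have h1 : Fintype.card (IncreasingPair t) =
      (Finset.univ.filter fun p : Fin t × Fin t => p.1 < p.2).card := Fintype.card_subtype _
  have h2 : (Finset.univ.filter fun p : Fin t × Fin t => p.1 < p.2).card =
      (Finset.univ.filter fun p : Fin t × Fin t => p.2 < p.1).card :=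
    Finset.card_equiv (Equiv.prodComm _ _) (by simp)
  have h3 : (Finset.univ.filter fun p : Fin t × Fin t => p.1 = p.2).card = t := by
    have : (Finset.univ.filter fun p : Fin t × Fin t => p.1 = p.2) =
        Finset.univ.image fun i => (i, i) := by
      ext ⟨i, j⟩
      simp
    rw [this, Finset.card_image_of_injective _ fun i j h => congrArg Prod.fst h]
    simp
  have h4 : (Finset.univ : Finset (Fin t × Fin t)).card = t * t := by simp
  have h5 : (Finset.univ : Finset (Fin t × Fin t)) =
      (Finset.univ.filter fun p : Fin t × Fin t => p.1 < p.2) ∪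
      (Finset.univ.filter fun p : Fin t × Fin t => p.2 < p.1) ∪
      (Finset.univ.filter fun p : Fin t × Fin t => p.1 = p.2) := by
    ext ⟨i, j⟩
    simp only [Finset.mem_univ, Finset.mem_union, Finset.mem_filter, true_and, true_iff]
    rcases lt_trichotomy i j with h | h | h <;> simp [h]
  rw [h5, Finset.card_union_of_disjoint, Finset.card_union_of_disjoint, ← h2, h3, ← h1] at h4
  · omega
  · rw [Finset.disjoint_filter]
    exact fun _ _ h => not_lt_of_gt h
  · rw [Finset.disjoint_union_left, Finset.disjoint_filter, Finset.disjoint_filter]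
    exact ⟨fun _ _ h => h.ne, fun _ _ h => h.ne'⟩

/-- The probability that a random graph fails to be pseudorandom. -/
theorem randomGraphProb_not_pseudorandom_le (n t : ℕ) (hn : 5 ≤ n) :
    randomGraphProb n (fun G => ¬ Pseudorandom t G) ≤
      4 * (n ^ 5 * (999 / 1000 : ℝ) ^ (n - 5)) +
      4 * (n ^ (2 * t) * (999 / 1000 : ℝ) ^ Fintype.card (IncreasingPair t)) := by
  classical
  set ρ : ℝ := 999 / 1000 with hρ
  have hn1 : (1 : ℝ) ≤ n := by exact_mod_cast (by omega : 1 ≤ n)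
  have hρ0 : 0 ≤ ρ := by norm_num [hρ]
  have hρ1 : ρ ≤ 1 := by norm_num [hρ]
  have star : ∀ k ≤ 5, (n : ℝ) ^ k * ρ ^ (n - k) ≤ n ^ 5 * ρ ^ (n - 5) := fun k hk => by
    refine mul_le_mul (pow_le_pow_right₀ hn1 hk) (pow_le_pow_of_le_one hρ0 hρ1 (by omega))
      (by positivity) (by positivity)
  have pair : ∀ k ≤ 2, (n : ℝ) ^ (t * k) * ρ ^ Fintype.card (IncreasingPair t) ≤
      n ^ (2 * t) * ρ ^ Fintype.card (IncreasingPair t) := fun k hk => by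
    refine mul_le_mul_of_nonneg_right (pow_le_pow_right₀ hn1 ?_) (by positivity)
    rw [mul_comm 2 t]
    exact Nat.mul_le_mul_left t hk
  -- In each of the eight bounds the threshold `a / b` exceeds the probability of `Q` (31/32, 1/2,
  -- 1/4, 1/2, 1/2, 1/16, 1/2, 1/2). Each `μ` is chosen so that the same `ρ` works throughout.
  have b1 := (randomGraphProb_star_le n (κ := Fin 5) (fun θ => ¬ ∀ k, θ k = true) 1 1
    (μ := 2) (ρ := ρ) (by norm_num)
    (by rw [show (Finset.univ.filter fun θ : Fin 5 → Bool => ¬ ∀ k, θ k = true).card = 31 by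
          decide +kernel]; norm_num [hρ]) hρ0).trans (star _ (by simp))
  have b2 := (randomGraphProb_star_le n (κ := Fin 1) (fun θ => θ 0 = true) 3 5
    (μ := 11 / 10) (ρ := ρ) (by norm_num)
    (by rw [show (Finset.univ.filter fun θ : Fin 1 → Bool => θ 0 = true).card = 1 by
          decide +kernel]; norm_num [hρ]) hρ0).trans (star _ (by simp))
  have b3 := (randomGraphProb_star_le n (κ := Fin 2) (fun θ => θ 0 = false ∧ θ 1 = false) 3 10
    (μ := 51 / 50) (ρ := ρ) (by norm_num)
    (by rw [show (Finset.univ.filter fun θ : Fin 2 → Bool => θ 0 = false ∧ θ 1 = false).card = 1 by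
          decide +kernel]; norm_num [hρ]) hρ0).trans (star _ (by simp))
  have b4 := (randomGraphProb_star_le n (κ := Fin 2) (fun θ => θ 0 = θ 1) 3 5
    (μ := 11 / 10) (ρ := ρ) (by norm_num)
    (by rw [show (Finset.univ.filter fun θ : Fin 2 → Bool => θ 0 = θ 1).card = 2 by
          decide +kernel]; norm_num [hρ]) hρ0).trans (star _ (by simp))
  have b5 := (randomGraphProb_pair_le n t (κ := Fin 1) (fun θ => θ (0, 0) = false) 1 1
    (μ := 2) (ρ := ρ) (by norm_num)
    (by rw [show (Finset.univ.filter fun θ : Fin 1 × Fin 1 → Bool => θ (0, 0) = false).card = 1 by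
          decide +kernel]; norm_num [hρ]) hρ0).trans (pair _ (by simp))
  have b6 := (randomGraphProb_pair_le n t (κ := Fin 2) (fun θ => ∀ k, θ k = false) 1 8
    (μ := 11 / 10) (ρ := ρ) (by norm_num)
    (by rw [show (Finset.univ.filter fun θ : Fin 2 × Fin 2 → Bool => ∀ k, θ k = false).card = 1 by
          decide +kernel]; norm_num [hρ]) hρ0).trans (pair _ (by simp))
  have b7 := (randomGraphProb_pair_le n t (κ := Fin 1) (fun θ => θ (0, 0) = true) 7 8
    (μ := 11 / 10) (ρ := ρ) (by norm_num)
    (by rw [show (Finset.univ.filter fun θ : Fin 1 × Fin 1 → Bool => θ (0, 0) = true).card = 1 by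
          decide +kernel]; norm_num [hρ]) hρ0).trans (pair _ (by simp))
  have b8 := (randomGraphProb_pair_le n t (κ := Fin 2) (fun θ => θ (0, 0) = θ (1, 1)) 1 1
    (μ := 2) (ρ := ρ) (by norm_num)
    (by rw [show (Finset.univ.filter fun θ : Fin 2 × Fin 2 → Bool =>
          θ (0, 0) = θ (1, 1)).card = 8 by decide +kernel]; norm_num [hρ]) hρ0).trans
    (pair _ (by simp))
  have u1 := (randomGraphProb_or_le _ _).trans (add_le_add
    ((randomGraphProb_or_le _ _).trans (add_le_add b1 b2))
    ((randomGraphProb_or_le _ _).trans (add_le_add b3 b4)))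
  have u2 := (randomGraphProb_or_le _ _).trans (add_le_add
    ((randomGraphProb_or_le _ _).trans (add_le_add b5 b6))
    ((randomGraphProb_or_le _ _).trans (add_le_add b7 b8)))
  have u := (randomGraphProb_or_le _ _).trans (add_le_add u1 u2)
  refine (randomGraphProb_mono fun G hG => ?_).trans (u.trans (by linarith))
  clear u u1 u2 b1 b2 b3 b4 b5 b6 b7 b8
  by_contra hcon
  simp only [not_or, not_exists, not_le, one_mul, Fintype.card_fin, decide_eq_true_eq,
    decide_eq_false_iff_not, decide_eq_decide, Prod.forall] at hcon
  obtain ⟨⟨⟨h1, h2⟩, h3, h4⟩, ⟨h5, h6⟩, h7, h8⟩ := hcon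
  have pairs_card : ∀ (R : IncreasingPair t → Prop) [DecidablePred R],
      (Finset.univ.filter R).card < Fintype.card (IncreasingPair t) → ∃ p, ¬ R p := by
    intro R _ h
    by_contra! hR
    rw [Finset.filter_true_of_mem fun p _ => hR p, Finset.card_univ] at h
    exact lt_irrefl _ h
  let single : (Fin t ↪ Fin n) → (Fin t × Fin 1 ↪ Fin n) := fun φ =>
    (Equiv.prodUnique _ _).toEmbedding.trans φ
  have two : ∀ x y : Fin n, x ≠ y → ∃ ψ : Fin 2 ↪ Fin n, ψ 0 = x ∧ ψ 1 = y := fun x y h =>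
    ⟨⟨![x, y], by intro i j; fin_cases i <;> fin_cases j <;> simp [h, h.symm]⟩, rfl, rfl⟩
  refine hG ⟨fun ψ => ?_, fun v => ?_, fun x y hxy => ?_, fun x y hxy => ?_, fun φ => ?_,
    fun φ => ?_, fun φ => ?_, fun φ => ?_⟩
  · by_contra! hz
    have h := h1 ψ
    have hc := card_filter_ne_embedding ψ
    rw [Fintype.card_fin, Fintype.card_fin] at hc
    rw [← hc] at h
    refine absurd (Finset.card_le_card fun z hz' => ?_) (not_le_of_gt h)
    simp only [Finset.mem_filter, Finset.mem_univ, true_and] at hz' ⊢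
    exact ⟨hz', not_forall.2 (hz z)⟩
  · have h := h2 ⟨fun _ => v, fun _ _ _ => Subsingleton.elim _ _⟩
    rw [Fintype.card_fin]
    refine (Nat.mul_le_mul_left 5 (Finset.card_le_card fun z hz => ?_)).trans
      (h.le.trans (Nat.mul_le_mul_left 3 (Nat.sub_le n 1)))
    simp only [Finset.mem_filter, Finset.mem_univ, true_and] at hz ⊢
    exact ⟨fun _ => hz.ne', hz⟩
  · obtain ⟨ψ, rfl, rfl⟩ := two x y hxy
    rw [Fintype.card_fin]
    refine (Nat.mul_le_mul_left 10 (Finset.card_le_card fun z hz => ?_)).trans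
      ((h3 ψ).le.trans (Nat.mul_le_mul_left 3 (Nat.sub_le n 2)))
    simp only [Finset.mem_filter, Finset.mem_univ, true_and, Fin.forall_fin_two] at hz ⊢
    tauto
  · obtain ⟨ψ, rfl, rfl⟩ := two x y hxy
    rw [Fintype.card_fin]
    refine (Nat.mul_le_mul_left 5 (Finset.card_le_card fun z hz => ?_)).trans
      ((h4 ψ).le.trans (Nat.mul_le_mul_left 3 (Nat.sub_le n 2)))
    simp only [Finset.mem_filter, Finset.mem_univ, true_and, Fin.forall_fin_two] at hz ⊢
    tauto
  · obtain ⟨p, hp⟩ := pairs_card _ (h5 (single φ))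
    exact ⟨p, not_not.1 hp⟩
  · exact h6 φ
  · exact h7 (single φ)
  · exact pairs_card _ (h8 φ)

end RandomPseudorandom

/-! ### Vanishing of the failure probability -/

section Asymptotics

lemma tendsto_pow_mul_pow_pred (k : ℕ) {r : ℝ} (h0 : 0 < r) (h1 : r < 1) :
    Tendsto (fun t : ℕ => (4 * ((t : ℝ) + 1)) ^ k * r ^ (t - 1)) atTop (𝓝 0) := by
  have h := (tendsto_pow_const_mul_const_pow_of_abs_lt_one k
    (r := r) (by rwa [abs_of_pos h0])).const_mul (8 ^ k * r⁻¹)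
  rw [mul_zero] at h
  refine squeeze_zero' (Eventually.of_forall fun t => by positivity) ?_ h
  filter_upwards [eventually_ge_atTop 1] with t ht
  have ht' : (1 : ℝ) ≤ t := by exact_mod_cast ht
  have e1 : r ^ t = r ^ (t - 1) * r := by rw [← pow_succ]; congr 1; omega
  calc (4 * ((t : ℝ) + 1)) ^ k * r ^ (t - 1) ≤ (8 * t) ^ k * r ^ (t - 1) := by
        refine mul_le_mul_of_nonneg_right (pow_le_pow_left₀ (by positivity) ?_ k) (by positivity)
        linarith
    _ = 8 ^ k * r⁻¹ * (t ^ k * r ^ t) := by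
        rw [e1, mul_pow]; field_simp

lemma tendsto_sqrt_div_four : Tendsto (fun n : ℕ => Nat.sqrt n / 4) atTop atTop := by
  refine tendsto_atTop.2 fun b => ?_
  filter_upwards [eventually_ge_atTop ((4 * b) ^ 2)] with n hn
  have := Nat.le_sqrt'.2 hn
  omega

/-- The factor `n.choose 2 + 1` pays for later fixing the number of edges. With `t` of order `√n`,
the gain `ρ ^ (t(t-1)/2)` beats the `n ^ (2 * t)` choices of vertices. -/
lemma tendsto_failure_bound :
    Tendsto (fun n : ℕ => ((n.choose 2 : ℝ) + 1) *
      (4 * (n ^ 5 * (999 / 1000 : ℝ) ^ (n - 5)) +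
      4 * (n ^ (2 * (Nat.sqrt n / 4)) *
        (999 / 1000 : ℝ) ^ Fintype.card (IncreasingPair (Nat.sqrt n / 4))))) atTop (𝓝 0) := by
  set ρ : ℝ := 999 / 1000 with hρ
  have hρ0 : 0 < ρ := by norm_num [hρ]
  have hρ1 : ρ < 1 := by norm_num [hρ]
  set r := √ρ with hr
  have hr0 : 0 < r := Real.sqrt_pos.2 hρ0
  have hr1 : r < 1 := by rw [hr, Real.sqrt_lt' one_pos]; simpa using hρ1
  have hrr : r ^ 2 = ρ := Real.sq_sqrt hρ0.le
  have l1 : Tendsto (fun n : ℕ => 4 * (ρ ^ 5)⁻¹ * ((n : ℝ) ^ 7 * ρ ^ n)) atTop (𝓝 0) := by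
    have := (tendsto_pow_const_mul_const_pow_of_abs_lt_one 7
      (r := ρ) (by rwa [abs_of_pos hρ0])).const_mul (4 * (ρ ^ 5)⁻¹)
    rwa [mul_zero] at this
  have l2 : Tendsto (fun n : ℕ => 4 * ((4 * (((Nat.sqrt n / 4 : ℕ) : ℝ) + 1)) ^ 8 *
      r ^ (Nat.sqrt n / 4 - 1))) atTop (𝓝 0) := by
    have := ((tendsto_pow_mul_pow_pred 8 hr0 hr1).comp tendsto_sqrt_div_four).const_mul 4
    rwa [mul_zero] at this
  have hy := ((tendsto_pow_mul_pow_pred 8 hr0 hr1).comp tendsto_sqrt_div_four).eventually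
    (gt_mem_nhds one_pos)
  have l := l1.add l2
  rw [add_zero] at l
  refine squeeze_zero' (Eventually.of_forall fun n => by positivity) ?_ l
  filter_upwards [hy, tendsto_sqrt_div_four.eventually_ge_atTop 1, eventually_ge_atTop 5]
    with n hy1 ht hn
  simp only [Function.comp] at hy1
  set t := Nat.sqrt n / 4 with ht_def
  have hC : (n.choose 2 : ℝ) + 1 ≤ n ^ 2 := by
    have : n.choose 2 + 1 ≤ n ^ 2 := by
      have := Nat.choose_two_right n
      have h2 : n * (n - 1) ≤ n * n - n := by rw [Nat.mul_sub_one]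
      have h3 : n * 5 ≤ n * n := Nat.mul_le_mul_left n hn
      rw [pow_two]
      omega
    exact_mod_cast this
  have e1 : ρ ^ n = ρ ^ (n - 5) * ρ ^ 5 := by rw [← pow_add]; congr 1; omega
  have hnt : (n : ℝ) ≤ (4 * ((t : ℝ) + 1)) ^ 2 := by
    have h1 : n < (4 * (t + 1)) ^ 2 := by
      rw [← Nat.sqrt_lt']
      omega
    exact_mod_cast h1.le
  have hn1 : (1 : ℝ) ≤ n := by exact_mod_cast (by omega : 1 ≤ n)
  -- The square root `r` of `ρ` absorbs the half in `t(t-1)/2`, making the whole term a `t`-th power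
  -- whose base tends to zero.
  have hIP : ρ ^ Fintype.card (IncreasingPair t) = (r ^ (t - 1)) ^ t := by
    rw [← hrr, ← pow_mul, ← pow_mul]
    congr 1
    have := two_mul_card_increasingPair_add t
    rw [Nat.sub_mul, one_mul]
    omega
  have h4 : (1 : ℝ) ≤ 4 * ((t : ℝ) + 1) := by
    have : (0 : ℝ) ≤ t := by positivity
    linarith
  have key : (n : ℝ) ^ 2 * (n ^ (2 * t) * ρ ^ Fintype.card (IncreasingPair t)) ≤
      (4 * ((t : ℝ) + 1)) ^ 8 * r ^ (t - 1) := by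
    calc (n : ℝ) ^ 2 * (n ^ (2 * t) * ρ ^ Fintype.card (IncreasingPair t))
        = n ^ (2 + 2 * t) * (r ^ (t - 1)) ^ t := by rw [hIP]; ring
      _ ≤ n ^ (4 * t) * (r ^ (t - 1)) ^ t := by
          refine mul_le_mul_of_nonneg_right (pow_le_pow_right₀ hn1 ?_) (by positivity)
          omega
      _ ≤ ((4 * ((t : ℝ) + 1)) ^ 2) ^ (4 * t) * (r ^ (t - 1)) ^ t := by gcongr
      _ = ((4 * ((t : ℝ) + 1)) ^ 8 * r ^ (t - 1)) ^ t := by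
          rw [mul_pow ((4 * ((t : ℝ) + 1)) ^ 8), ← pow_mul, ← pow_mul (4 * ((t : ℝ) + 1)) 8]
          congr 2
          ring
      _ ≤ ((4 * ((t : ℝ) + 1)) ^ 8 * r ^ (t - 1)) ^ 1 :=
          pow_le_pow_of_le_one (by positivity) hy1.le ht
      _ = _ := pow_one _
  calc ((n.choose 2 : ℝ) + 1) * (4 * (n ^ 5 * ρ ^ (n - 5)) +
        4 * (n ^ (2 * t) * ρ ^ Fintype.card (IncreasingPair t)))
      ≤ n ^ 2 * (4 * (n ^ 5 * ρ ^ (n - 5)) +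
        4 * (n ^ (2 * t) * ρ ^ Fintype.card (IncreasingPair t))) := by gcongr
    _ = 4 * (ρ ^ 5)⁻¹ * (n ^ 7 * ρ ^ n) +
        4 * (n ^ 2 * (n ^ (2 * t) * ρ ^ Fintype.card (IncreasingPair t))) := by
        rw [e1]; field_simp
    _ ≤ _ := by gcongr

/-- A graph on at least one hundred vertices that is pseudorandom at the scale of the square root
of its order. -/
def Typical (n : ℕ) (G : SimpleGraph (Fin n)) : Prop :=
  100 ≤ n ∧ Pseudorandom (Nat.sqrt n / 4) G

lemma Typical.scale_le {n : ℕ} {G : SimpleGraph (Fin n)} (_hG : Typical n G) :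
    16 * (Nat.sqrt n / 4) ^ 2 ≤ Fintype.card (Fin n) := by
  rw [Fintype.card_fin]
  have h1 : 4 * (Nat.sqrt n / 4) ≤ Nat.sqrt n := Nat.mul_div_le _ _
  have h2 := Nat.sqrt_le' n
  nlinarith [Nat.pow_le_pow_left h1 2]

lemma Typical.card_ge {n : ℕ} {G : SimpleGraph (Fin n)} (hG : Typical n G) :
    100 ≤ Fintype.card (Fin n) := by
  rw [Fintype.card_fin]; exact hG.1

lemma Typical.ttRigid {n : ℕ} {G : SimpleGraph (Fin n)} (hG : Typical n G) : TTRigid G :=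
  hG.2.ttRigid hG.scale_le hG.card_ge

/-- The probability of not being typical is small even after multiplication by the number of
possible edge counts. -/
theorem tendsto_randomGraphProb_not_typical :
    Tendsto (fun n : ℕ => ((n.choose 2 : ℝ) + 1) * randomGraphProb n fun G => ¬ Typical n G)
      atTop (𝓝 0) := by
  refine squeeze_zero' (Eventually.of_forall fun n =>
    mul_nonneg (by positivity) (randomGraphProb_nonneg n _)) ?_ tendsto_failure_bound
  filter_upwards [eventually_ge_atTop 100] with n hn
  refine mul_le_mul_of_nonneg_left ?_ (by positivity)
  refine (randomGraphProb_mono fun G hG => ?_).trans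
    (randomGraphProb_not_pseudorandom_le n (Nat.sqrt n / 4) (by omega))
  exact fun h => hG ⟨hn, h⟩

theorem almostSurely_ttRigid : AlmostSurely fun _ G => TTRigid G := by
  have h : Tendsto (fun n : ℕ => 1 - ((n.choose 2 : ℝ) + 1) *
      randomGraphProb n fun G => ¬ Typical n G) atTop (𝓝 1) := by
    simpa using tendsto_randomGraphProb_not_typical.const_sub 1
  refine tendsto_of_tendsto_of_tendsto_of_le_of_le h tendsto_const_nhds (fun n => ?_)
    (fun n => ?_)
  · have h1 := randomGraphProb_not n (Typical n)
    have h2 := randomGraphProb_nonneg n fun G => ¬ Typical n G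
    have h3 : randomGraphProb n (Typical n) ≤ randomGraphProb n fun G => TTRigid G :=
      randomGraphProb_mono fun G hG => hG.ttRigid
    have h4 : (0 : ℝ) ≤ n.choose 2 := by positivity
    change 1 - _ ≤ randomGraphProb n fun G => TTRigid G
    nlinarith
  · have h1 := randomGraphProb_not n fun G => TTRigid G
    have h2 := randomGraphProb_nonneg n fun G => ¬ TTRigid G
    change (randomGraphProb n fun G => TTRigid G) ≤ 1
    linarith

end Asymptotics

/-! ### Isomorphism classes of typical balanced graphs -/

section Families

/-- The number of edges of a balanced graph: half of all pairs of vertices. -/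
abbrev halfEdges (n : ℕ) : ℕ := n.choose 2 / 2

open Classical in
/-- The typical graphs having half of all possible edges. -/
noncomputable def typicalBalanced (n : ℕ) : Finset (SimpleGraph (Fin n)) :=
  Finset.univ.filter fun G => Typical n G ∧ G.edgeSet.ncard = halfEdges n

open Classical in
lemma exists_representatives (n : ℕ) : ∃ F ⊆ typicalBalanced n,
    (∀ G ∈ F, ∀ H ∈ F, Nonempty (G ≃g H) → G = H) ∧
    ∀ H ∈ typicalBalanced n, ∃ G ∈ F, Nonempty (G ≃g H) := by
  let s : Setoid (SimpleGraph (Fin n)) :=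
    ⟨fun G H => Nonempty (G ≃g H), fun G => ⟨SimpleGraph.Iso.refl⟩, fun ⟨σ⟩ => ⟨σ.symm⟩,
      fun ⟨σ⟩ ⟨τ⟩ => ⟨τ.comp σ⟩⟩
  let q : SimpleGraph (Fin n) → Quotient s := Quotient.mk s
  obtain ⟨F, hF, hinj, himg⟩ := Finset.exists_subset_injOn_image_eq_of_surjOn (f := q)
    (typicalBalanced n : Set (SimpleGraph (Fin n))) ((typicalBalanced n).image q)
    (by rw [Finset.coe_image]; exact Set.surjOn_image _ _)
  refine ⟨F, by exact_mod_cast hF, fun G hG H hH h => hinj hG hH (Quotient.sound h),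
    fun H hH => ?_⟩
  have : q H ∈ F.image q := by rw [himg]; exact Finset.mem_image_of_mem q hH
  obtain ⟨G, hG, h⟩ := Finset.mem_image.1 this
  exact ⟨G, hG, Quotient.exact h⟩

lemma map_eq_of_iso {n : ℕ} {G H : SimpleGraph (Fin n)} (σ : G ≃g H) :
    G.map σ.toEquiv.toEmbedding = H := by
  ext u v
  rw [SimpleGraph.map_adj]
  constructor
  · rintro ⟨a, b, h, rfl, rfl⟩
    exact σ.map_adj_iff.2 h
  · intro h
    exact ⟨σ.symm u, σ.symm v, σ.symm.map_adj_iff.2 h, by simp, by simp⟩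

/-- Pairwise non-isomorphic representatives of the typical balanced graphs are counted by the
orbits of the symmetric group, up to the proportion of non-typical graphs. -/
lemma card_representatives (n : ℕ) {F : Finset (SimpleGraph (Fin n))}
    (hF : F ⊆ typicalBalanced n)
    (hiso : ∀ G ∈ F, ∀ H ∈ F, Nonempty (G ≃g H) → G = H)
    (hrep : ∀ H ∈ typicalBalanced n, ∃ G ∈ F, Nonempty (G ≃g H)) :
    F.card * n.factorial ≤ (n.choose 2).choose (halfEdges n) ∧
    (typicalBalanced n).card ≤ F.card * n.factorial := by
  classical
  let m : SimpleGraph (Fin n) × Equiv.Perm (Fin n) → SimpleGraph (Fin n) :=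
    fun x => x.1.map x.2.toEmbedding
  have hcard : (F ×ˢ (Finset.univ : Finset (Equiv.Perm (Fin n)))).card = F.card * n.factorial := by
    rw [Finset.card_product, Finset.card_univ, Fintype.card_perm, Fintype.card_fin]
  have hF' : ∀ G ∈ F, Typical n G ∧ G.edgeSet.ncard = halfEdges n := fun G hG => by
    simpa [typicalBalanced] using hF hG
  rw [← hcard, ← card_filter_ncard_edgeSet]
  constructor
  -- Relabelling is injective on pairs: equal results give an isomorphism `τ⁻¹σ` between
  -- representatives, which are then equal, and it is trivial by rigidity.
  · refine Finset.card_le_card_of_injOn m ?_ ?_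
    · rintro ⟨G, σ⟩ h
      simp only [Finset.coe_product, Set.mem_prod, Finset.mem_coe] at h
      simp only [Finset.coe_filter, Finset.mem_univ, true_and, Set.mem_ofPred_eq, m]
      rw [SimpleGraph.edgeSet_map, Set.ncard_image_of_injective _
        (Function.Embedding.injective _)]
      exact (hF' G h.1).2
    · rintro ⟨G, σ⟩ h ⟨H, τ⟩ h' heq
      simp only [Finset.coe_product, Set.mem_prod, Finset.mem_coe] at h h'
      simp only [m] at heq
      let i2 : G ≃g H :=
        { toEquiv := σ.trans τ.symm
          map_rel_iff' := by
            intro a b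
            have e1 : ∀ (K : SimpleGraph (Fin n)) (π : Equiv.Perm (Fin n)) a b,
                (K.map π.toEmbedding).Adj (π a) (π b) ↔ K.Adj a b := fun K π a b =>
              (SimpleGraph.Iso.map π K).map_adj_iff
            have e2 := e1 H τ (τ.symm (σ a)) (τ.symm (σ b))
            rw [← heq, Equiv.apply_symm_apply, Equiv.apply_symm_apply, e1 G σ] at e2
            exact e2.symm }
      have hGH : G = H := hiso G h.1 H h'.1 ⟨i2⟩
      subst hGH
      have hT := (hF' G h.1).1
      have : σ = τ := by
        ext x
        have := hT.2.aut_eq_refl hT.scale_le hT.card_ge i2 x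
        have h3 : τ.symm (σ x) = x := this
        rw [Equiv.symm_apply_eq] at h3
        rw [h3]
      rw [this]
  · refine Finset.card_le_card_of_surjOn m ?_
    intro H hH
    obtain ⟨G, hG, ⟨σ⟩⟩ := hrep H hH
    refine ⟨(G, σ.toEquiv), by simp [hG], map_eq_of_iso σ⟩

/-- Lets a bound on the probability of being non-typical among all graphs pass to the balanced ones,
at the cost of a factor `N + 1`. -/
lemma two_pow_le_mul_choose_half (N : ℕ) : 2 ^ N ≤ (N + 1) * N.choose (N / 2) := by
  rw [← Nat.sum_range_choose N]
  calc ∑ m ∈ Finset.range (N + 1), N.choose m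
      ≤ ∑ _m ∈ Finset.range (N + 1), N.choose (N / 2) :=
        Finset.sum_le_sum fun m _ => Nat.choose_le_middle m N
    _ = _ := by simp

/-- Almost all balanced graphs are typical. -/
lemma card_typicalBalanced_ge (n : ℕ) :
    ((n.choose 2).choose (halfEdges n) : ℝ) * (1 - ((n.choose 2 : ℝ) + 1) *
      randomGraphProb n fun G => ¬ Typical n G) ≤ (typicalBalanced n).card := by
  classical
  set C : ℝ := ((n.choose 2).choose (halfEdges n) : ℝ)
  set p := randomGraphProb n fun G => ¬ Typical n G with hp
  have h1 : (n.choose 2).choose (halfEdges n) ≤ (typicalBalanced n).card +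
      (Finset.univ.filter fun G : SimpleGraph (Fin n) => ¬ Typical n G).card := by
    rw [← card_filter_ncard_edgeSet]
    refine (Finset.card_le_card fun G hG => ?_).trans (Finset.card_union_le _ _)
    simp only [typicalBalanced, Finset.mem_union, Finset.mem_filter, Finset.mem_univ,
      true_and] at hG ⊢
    tauto
  have h2 : ((Finset.univ.filter fun G : SimpleGraph (Fin n) => ¬ Typical n G).card : ℝ) =
      p * 2 ^ n.choose 2 := by
    rw [hp, randomGraphProb_eq_card_filter, div_mul_cancel₀ _ (by positivity)]
  have h3 : (2 : ℝ) ^ n.choose 2 ≤ ((n.choose 2 : ℝ) + 1) * C := by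
    simp only [C]
    exact_mod_cast two_pow_le_mul_choose_half (n.choose 2)
  have h4 : p * 2 ^ n.choose 2 ≤ p * (((n.choose 2 : ℝ) + 1) * C) :=
    mul_le_mul_of_nonneg_left h3 (randomGraphProb_nonneg n _)
  have h5 : C ≤ (typicalBalanced n).card + p * 2 ^ n.choose 2 := by
    rw [← h2]
    simp only [C]
    exact_mod_cast h1
  linarith

end Families

end TTGraph

theorem mainTheorem7 :
    TTGraph.AlmostSurely (fun _ G => TTGraph.TTRigid G) ∧
    ∃ (F : ∀ n : ℕ, Finset (SimpleGraph (Fin n))) (ε : ℕ → ℝ),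
      Tendsto ε atTop (𝓝 0) ∧
      ∀ n : ℕ,
        (∀ G ∈ F n, TTGraph.TTRigid G) ∧
        (∀ G ∈ F n, ∀ H ∈ F n, G ≠ H → TTGraph.TTIncomparable G H) ∧
        ((F n).card : ℝ) =
          1 / (n.factorial : ℝ) * (((n.choose 2).choose (n.choose 2 / 2) : ℕ) : ℝ) *
            (1 - ε n) := by
  refine ⟨TTGraph.almostSurely_ttRigid, ?_⟩
  choose F hF hiso hrep using TTGraph.exists_representatives
  have hC : ∀ n : ℕ, (0 : ℝ) < ((n.choose 2).choose (n.choose 2 / 2) : ℕ) := fun n => by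
    exact_mod_cast Nat.choose_pos (Nat.div_le_self _ _)
  have hn : ∀ n : ℕ, (0 : ℝ) < n.factorial := fun n => by exact_mod_cast n.factorial_pos
  -- `ε n` is defined as the exact relative deficit, so the cardinality formula is an identity and
  -- only the limit needs proof.
  refine ⟨F, fun n => 1 - (F n).card * n.factorial /
    (((n.choose 2).choose (n.choose 2 / 2) : ℕ) : ℝ), ?_, fun n => ⟨?_, ?_, ?_⟩⟩
  · refine tendsto_of_tendsto_of_tendsto_of_le_of_le tendsto_const_nhds
      TTGraph.tendsto_randomGraphProb_not_typical (fun n => ?_) (fun n => ?_)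
    · have h := (TTGraph.card_representatives n (hF n) (hiso n) (hrep n)).1
      simp only [sub_nonneg]
      rw [div_le_one (hC n)]
      exact_mod_cast h
    · have h := (TTGraph.card_representatives n (hF n) (hiso n) (hrep n)).2
      have h' : ((TTGraph.typicalBalanced n).card : ℝ) ≤ (F n).card * n.factorial := by
        exact_mod_cast h
      have h2 := (TTGraph.card_typicalBalanced_ge n).trans h'
      rw [mul_comm, ← le_div_iff₀ (hC n)] at h2
      simp only
      linarith
  · intro G hG
    have h := hF n hG
    simp only [TTGraph.typicalBalanced, Finset.mem_filter] at h
    exact h.2.1.ttRigid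
  · have key : ∀ G ∈ F n, ∀ H ∈ F n, G ≠ H → ¬ ∃ f, TTGraph.IsTT G H f := by
      intro G hG H hH hne hf
      have h := hF n hG
      have h' := hF n hH
      simp only [TTGraph.typicalBalanced, Finset.mem_filter] at h h'
      exact hne (hiso n G hG H hH (h.2.1.2.nonempty_iso h'.2.1.2 h.2.1.scale_le h.2.1.card_ge
        (h.2.2.trans h'.2.2.symm) hf))
    exact fun G hG H hH hne => ⟨key G hG H hH hne, key H hH G hG hne.symm⟩
  · have h1 := (hC n).ne'
    have h2 := (hn n).ne'
    field_simp
    ring
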